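/- Let $n\ge 1$. For $p\in[1,\infty)$ let $X^p$ be the set of measurable $f:\mathbb{R}^n\times\mathbb{R}\to\mathbb{R}$ with $\|f\|_{L^p(\mathbb{R}^n\times(-\infty,T))}<\infty$ for all $T\in\mathbb{R}$ (functions that agree almost everywhere are identified). For $\alpha>0$ put $$\Phi_\alpha(x,t)=\frac{t^{\alpha-1}}{\Gamma(\alpha)}\,\frac{1}{(4\pi t)^{n/2}}\,e^{-|x|^2/(4t)}\,\chi_{(0,\infty)}(t),\qquad J_\alpha f(x,t)=\iint_{\mathbb{R}^n\times(-\infty,t)}\Phi_\alpha(x-\xi,t-\tau)f(\xi,\tau)\,d\xi\,d\tau ,$$ and $Y^p_\alpha=J_\alpha(X^p)$. Whenever $$\Big(p>1\text{ and }0<\alpha<\tfrac{n+2}{2p}\Big)\quad\text{or}\quad\Big(p=1\text{ and }0<\alpha\le\tfrac{n+2}{2p}\Big),\qquad (\ast)$$ the integral defining $J_\alpha f$ converges absolutely almost everywhere for $f\in X^p$, and $J_\alpha:X^p\to Y^p_\alpha$ is a bijection; the fractional heat operator $(\partial_t-\Delta)^\alpha:Y^p_\alpha\to X^p$ is defined as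 its inverse. **Theorem 2.2.** Let $p,q\in[1,\infty)$ and $\lambda,\sigma,\alpha,\beta\in(0,\infty)$ be such that $(p,\alpha)$ satisfies $(\ast)$, $(q,\beta)$ satisfies $(\ast)$ (with $q,\beta$ in place of $p,\alpha$), and $$(n+2-2p\alpha)q^2\sigma\le(n+2-2q\beta)p^2\lambda,\qquad 2p\alpha<n+2,\qquad \sigma<\frac1\lambda .$$ Let $u\in Y^p_\alpha$ and $v\in Y^q_\beta$ satisfy $$0\le(\partial_t-\Delta)^\alpha u\le v^\lambda\quad\text{and}\quad 0\le(\partial_t-\Delta)^\beta v\le u^\sigma\quad\text{a.e. in }\mathbb{R}^n\times\mathbb{R},\qquad u=v=0\quad\text{a.e. in }\mathbb{R}^n\times(-\infty,0).$$ (Then $u,v\ge0$ a.e., since $\Phi_\alpha,\Phi_\beta\ge0$.) Then for all $T>0$ $$\|u\|_{L^\infty(\mathbb{R}^n\times(0,T))}\le M_2^{\frac{\lambda}{1-\lambda\sigma}}\,T^{\gamma_2/\sigma}\qquad\text{and}\qquad \|v\|_{L^\infty(\mathbb{R}^n\times(0,T))}\le M_1^{\frac{\sigma}{1-\lambda\sigma}}\,T^{\gamma_1/\lambda},$$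 where $$\gamma_1=\frac{(\beta+\alpha\sigma)\lambda}{1-\lambda\sigma},\qquad \gamma_2=\frac{(\alpha+\beta\lambda)\sigma}{1-\lambda\sigma},$$ $$M_1=\frac{\Gamma(\gamma_1+1)\,\Gamma(\gamma_2+1)^{1/\sigma}}{\Gamma(\alpha+\gamma_1+1)\,\Gamma(\beta+\gamma_2+1)^{1/\sigma}},\qquad M_2=\frac{\Gamma(\gamma_2+1)\,\Gamma(\gamma_1+1)^{1/\lambda}}{\Gamma(\beta+\gamma_2+1)\,\Gamma(\alpha+\gamma_1+1)^{1/\lambda}} .$$ -/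

import Mathlib

open MeasureTheory

noncomputable section

namespace FracHeat

/-- The fractional heat kernel
`Φ_α(x,t) = t^(α-1)/Γ(α) · (4πt)^(-n/2) · exp(-|x|²/(4t)) · χ_{(0,∞)}(t)`. -/
def kernel (n : ℕ) (α : ℝ) (x : EuclideanSpace ℝ (Fin n)) (t : ℝ) : ℝ :=
  if 0 < t then
    t ^ (α - 1) / Real.Gamma α * (1 / (4 * Real.pi * t) ^ ((n : ℝ) / 2))
      * Real.exp (-‖x‖ ^ 2 / (4 * t))
  else 0

/-- `J_α f(x,t) = ∬_{ℝⁿ × (-∞,t)} Φ_α(x-ξ,t-τ) f(ξ,τ) dξ dτ`. -/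
def J (n : ℕ) (α : ℝ) (f : EuclideanSpace ℝ (Fin n) × ℝ → ℝ)
    (z : EuclideanSpace ℝ (Fin n) × ℝ) : ℝ :=
  ∫ w in (Set.univ ×ˢ Set.Iio z.2 : Set (EuclideanSpace ℝ (Fin n) × ℝ)),
    kernel n α (z.1 - w.1) (z.2 - w.2) * f w

/-- `X^p`: the functions on `ℝⁿ × ℝ` lying in `L^p(ℝⁿ × (-∞,T))` for every real `T`. -/
def X (n : ℕ) (p : ℝ) : Set (EuclideanSpace ℝ (Fin n) × ℝ → ℝ) :=
  {f | ∀ T : ℝ, MemLp f (ENNReal.ofReal p)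
    (volume.restrict (Set.univ ×ˢ Set.Iio T : Set (EuclideanSpace ℝ (Fin n) × ℝ)))}

/-- The graph of the fractional heat operator `(∂_t - Δ)^α : Y^p_α → X^p`, the inverse of
`J_α : X^p → Y^p_α`: the relation holds when `f` is (a representative of) `(∂_t - Δ)^α u`.
Functions are identified when they agree almost everywhere. -/
def IsFracHeat (n : ℕ) (p α : ℝ) (u f : EuclideanSpace ℝ (Fin n) × ℝ → ℝ) : Prop :=
  f ∈ X n p ∧ J n α f =ᵐ[volume] u

/-- `Y^p_α = J_α(X^p)`, functions being identified when they agree almost everywhere. -/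
def Y (n : ℕ) (p α : ℝ) : Set (EuclideanSpace ℝ (Fin n) × ℝ → ℝ) :=
  {u | ∃ f ∈ X n p, J n α f =ᵐ[volume] u}

/-- The range of `p` and `α` for which `(∂_t - Δ)^α : Y^p_α → X^p` is defined. -/
def Admissible (n : ℕ) (p α : ℝ) : Prop :=
  (1 < p ∧ 0 < α ∧ α < ((n : ℝ) + 2) / (2 * p)) ∨
    (p = 1 ∧ 0 < α ∧ α ≤ ((n : ℝ) + 2) / (2 * p))

/-- `γ₁ = (β + ασ)λ / (1 - λσ)`. -/
def gamma₁ (lam σ α β : ℝ) : ℝ := (β + α * σ) * lam / (1 - lam * σ)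

/-- `γ₂ = (α + βλ)σ / (1 - λσ)`. -/
def gamma₂ (lam σ α β : ℝ) : ℝ := (α + β * lam) * σ / (1 - lam * σ)

/-- `M₁ = Γ(γ₁+1) Γ(γ₂+1)^(1/σ) / (Γ(α+γ₁+1) Γ(β+γ₂+1)^(1/σ))`. -/
def M₁ (lam σ α β : ℝ) : ℝ :=
  (Real.Gamma (gamma₁ lam σ α β + 1) * Real.Gamma (gamma₂ lam σ α β + 1) ^ (1 / σ)) /
    (Real.Gamma (α + gamma₁ lam σ α β + 1) * Real.Gamma (β + gamma₂ lam σ α β + 1) ^ (1 / σ))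

/-- `M₂ = Γ(γ₂+1) Γ(γ₁+1)^(1/λ) / (Γ(β+γ₂+1) Γ(α+γ₁+1)^(1/λ))`. -/
def M₂ (lam σ α β : ℝ) : ℝ :=
  (Real.Gamma (gamma₂ lam σ α β + 1) * Real.Gamma (gamma₁ lam σ α β + 1) ^ (1 / lam)) /
    (Real.Gamma (β + gamma₂ lam σ α β + 1) * Real.Gamma (α + gamma₁ lam σ α β + 1) ^ (1 / lam))

end FracHeat

end

/-!
The operator `(∂_t - Δ)^α` is inverted by convolution with a nonnegative kernel, so the claim is one
about the nonnegative densities `F = (∂_t - Δ)^α u` and `G = (∂_t - Δ)^β v`, which vanish for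
negative times and satisfy `F ≤ (J_β G)^λ` and `G ≤ (J_α F)^σ`. No smoothing property of `J_α`
between different Lebesgue spaces is needed: sublinearity of the nonlinearity does the work.

Boundedness. `J_α` maps `L^r(ℝⁿ × (0, T))` to itself with norm at most `T^α / Γ(α+1)` for every
`r ≥ 1`, by Schur's test (`lintegral_heatPotential_rpow_le`). Exchanging the two inequalities if
necessary, let `σ ≤ 1`. If `F ∈ L^r` with `r ≥ 1`, then `J_α F ∈ L^r`, `G ∈ L^(r/σ)`,
`J_β G ∈ L^(r/σ)` and `F ∈ L^(r/(λσ))`. Since `λσ < 1`, iteration sends the exponent to infinity.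
The constants stay under control because `m ↦ (D m)^(λσ)` has a finite positive fixed point, and
this fixed point bounds `F` (`ae_le_of_lintegral_rpow_step`). Its dependence on `T` is `T^γ₁`, so
that `F ≤ c t^γ₁` almost everywhere (`exists_ae_le_timePower`).

Sharp constants. `J_α` takes `t^γ` to `Γ(γ+1)/Γ(α+γ+1) t^(α+γ)` (`heatPotential_timePower`).
Inserting `F ≤ a t^γ₁` with the least possible `a` into both inequalities returns the same power
of `t`, and gives `a ≤ K a^(λσ)` with an explicit `K`; as `a` is finite, `a ≤ K^(1/(1-λσ))`. The
resulting bounds on `J_α F` and `J_β G` are exactly those with the constants `M₂` and `M₁`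
(`heatPotential_le_of_ae_le`).
-/

open MeasureTheory Set
open scoped ENNReal

noncomputable section

namespace FracHeat

variable {n : ℕ} {α β : ℝ}

/-! ### Potentials of nonnegative densities and of powers of time -/

/-- The Riemann–Liouville kernel `s^(α-1)/Γ(α)` on `s > 0`, extended by `0`: the integral of
`Φ_α(·, s)` over space. -/
def timeKernel (α s : ℝ) : ℝ := if 0 < s then s ^ (α - 1) / Real.Gamma α else 0

/-- The potential `J_α F` of an `ℝ≥0∞`-valued density, as a Lebesgue integral over all of
space-time: no convergence has to be assumed, and the restriction to `τ < t` is carried by the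
kernel, which vanishes for nonpositive times. -/
def heatPotential (n : ℕ) (α : ℝ) (F : EuclideanSpace ℝ (Fin n) × ℝ → ℝ≥0∞)
    (z : EuclideanSpace ℝ (Fin n) × ℝ) : ℝ≥0∞ :=
  ∫⁻ w, ENNReal.ofReal (kernel n α (z.1 - w.1) (z.2 - w.2)) * F w

/-- The function `t^γ` on `t > 0`, extended by `0`, with values in `ℝ≥0∞`. -/
def timePower (γ t : ℝ) : ℝ≥0∞ := (Ioi 0).indicator (fun τ => ENNReal.ofReal (τ ^ γ)) t

/-- The constant `Γ(γ+1)/Γ(α+γ+1)`, by which the fractional integral of order `α` multiplies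
`t^γ` while raising its exponent to `α + γ`. -/
def gammaRatio (α γ : ℝ) : ℝ := Real.Gamma (γ + 1) / Real.Gamma (α + γ + 1)

theorem gammaRatio_pos (hα : 0 < α) {γ : ℝ} (hγ : 0 ≤ γ) : 0 < gammaRatio α γ :=
  div_pos (Real.Gamma_pos_of_pos (by linarith)) (Real.Gamma_pos_of_pos (by linarith))

theorem measurable_timePower (γ : ℝ) : Measurable (timePower γ) :=
  Measurable.indicator (by fun_prop) measurableSet_Ioi

theorem timePower_of_pos {γ t : ℝ} (ht : 0 < t) : timePower γ t = ENNReal.ofReal (t ^ γ) :=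
  indicator_of_mem (show t ∈ Ioi (0 : ℝ) from ht) _

theorem timePower_of_nonpos {γ t : ℝ} (ht : t ≤ 0) : timePower γ t = 0 :=
  indicator_of_notMem (by simpa using ht) _

theorem timePower_rpow {γ s : ℝ} (hs : 0 < s) (t : ℝ) :
    timePower γ t ^ s = timePower (γ * s) t := by
  rcases lt_or_ge 0 t with ht | ht
  · rw [timePower_of_pos ht, timePower_of_pos ht, ENNReal.ofReal_rpow_of_nonneg (by positivity)
      hs.le, Real.rpow_mul ht.le]
  · rw [timePower_of_nonpos ht, timePower_of_nonpos ht, ENNReal.zero_rpow_of_pos hs]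

theorem measurable_kernel (n : ℕ) (α : ℝ) :
    Measurable fun z : EuclideanSpace ℝ (Fin n) × ℝ => kernel n α z.1 z.2 :=
  Measurable.ite (measurableSet_lt measurable_const measurable_snd) (by fun_prop) measurable_const

theorem kernel_nonneg (hα : 0 < α) (x : EuclideanSpace ℝ (Fin n)) (t : ℝ) :
    0 ≤ kernel n α x t := by
  unfold kernel
  split_ifs with ht
  · have := Real.Gamma_pos_of_pos hα
    positivity
  · exact le_rfl

theorem lintegral_kernel_space (hα : 0 < α) (t : ℝ) :
    ∫⁻ x : EuclideanSpace ℝ (Fin n), ENNReal.ofReal (kernel n α x t) =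
      ENNReal.ofReal (timeKernel α t) := by
  by_cases ht : 0 < t
  · have hΓ := Real.Gamma_pos_of_pos hα
    have hb : (0 : ℝ) < 1 / (4 * t) := by positivity
    have hgauss := GaussianFourier.integral_rexp_neg_mul_sq_norm
      (V := EuclideanSpace ℝ (Fin n)) hb
    have hpos : (0 : ℝ) < (Real.pi / (1 / (4 * t))) ^
        (Module.finrank ℝ (EuclideanSpace ℝ (Fin n)) / 2 : ℝ) := by positivity
    have hint : Integrable
        (fun v : EuclideanSpace ℝ (Fin n) => Real.exp (-(1 / (4 * t)) * ‖v‖ ^ 2)) := by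
      -- a Bochner integral that is not zero cannot be the junk value
      by_contra h
      rw [integral_undef h] at hgauss
      exact hpos.ne hgauss
    have hker : ∀ x : EuclideanSpace ℝ (Fin n), kernel n α x t =
        t ^ (α - 1) / Real.Gamma α * (1 / (4 * Real.pi * t) ^ ((n : ℝ) / 2)) *
          Real.exp (-(1 / (4 * t)) * ‖x‖ ^ 2) := by
      intro x
      rw [kernel, if_pos ht]
      congr 2
      ring
    simp_rw [hker]
    rw [← ofReal_integral_eq_lintegral_ofReal (hint.const_mul _)
      (Filter.Eventually.of_forall fun x => by positivity), integral_const_mul, hgauss,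
      timeKernel, if_pos ht, finrank_euclideanSpace_fin]
    have : Real.pi / (1 / (4 * t)) = 4 * Real.pi * t := by field_simp
    rw [this, mul_assoc, one_div_mul_cancel (by positivity), mul_one]
  · simp [kernel, timeKernel, ht]

/-- On densities depending on time alone, `J_α` is fractional integration in time. -/
theorem heatPotential_comp_snd (hα : 0 < α) {φ : ℝ → ℝ≥0∞} (hφ : Measurable φ)
    (z : EuclideanSpace ℝ (Fin n) × ℝ) :
    heatPotential n α (fun w => φ w.2) z =
      ∫⁻ τ, ENNReal.ofReal (timeKernel α (z.2 - τ)) * φ τ := by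
  have hm : Measurable fun w : EuclideanSpace ℝ (Fin n) × ℝ =>
      ENNReal.ofReal (kernel n α (z.1 - w.1) (z.2 - w.2)) :=
    ((measurable_kernel n α).comp (measurable_const.sub measurable_id)).ennreal_ofReal
  have hm2 : Measurable fun w : EuclideanSpace ℝ (Fin n) × ℝ =>
      ENNReal.ofReal (kernel n α (z.1 - w.1) (z.2 - w.2)) * φ w.2 :=
    hm.mul (hφ.comp measurable_snd)
  rw [heatPotential, Measure.volume_eq_prod, lintegral_prod_symm _ hm2.aemeasurable]
  refine lintegral_congr fun τ => ?_
  have hm' : Measurable fun x : EuclideanSpace ℝ (Fin n) =>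
      ENNReal.ofReal (kernel n α (z.1 - x) (z.2 - τ)) := hm.comp measurable_prodMk_right
  simp only
  rw [lintegral_mul_const _ hm', lintegral_sub_left_eq_self
    (fun x => ENNReal.ofReal (kernel n α x (z.2 - τ))) z.1, lintegral_kernel_space hα]

/-- The Beta integral, obtained by rescaling the normalised Beta density from `(0, 1)` to
`(0, t)`. -/
theorem lintegral_timeKernel_mul_rpow (hα : 0 < α) {γ : ℝ} (hγ : 0 ≤ γ) {t : ℝ} (ht : 0 < t) :
    ∫⁻ τ in Ioi 0, ENNReal.ofReal (timeKernel α (t - τ)) * ENNReal.ofReal (τ ^ γ) =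
      ENNReal.ofReal (Real.Gamma (γ + 1) / Real.Gamma (α + γ + 1) * t ^ (α + γ)) := by
  have hΓα := Real.Gamma_pos_of_pos hα
  have hΓ1 := Real.Gamma_pos_of_pos (show 0 < γ + 1 by linarith)
  have hΓ2 := Real.Gamma_pos_of_pos (show 0 < α + γ + 1 by linarith)
  set c : ℝ := Real.Gamma (γ + 1) / Real.Gamma (α + γ + 1) * t ^ (α + γ - 1) with hc
  have hc0 : 0 ≤ c := by positivity
  have hmeas : Measurable (fun x => ProbabilityTheory.betaPDF (γ + 1) α x) :=
    (ProbabilityTheory.measurable_betaPDFReal _ _).ennreal_ofReal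
  have key : ∀ τ : ℝ, (Ioi (0 : ℝ)).indicator (fun τ =>
      ENNReal.ofReal (timeKernel α (t - τ)) * ENNReal.ofReal (τ ^ γ)) τ =
      ENNReal.ofReal c * ProbabilityTheory.betaPDF (γ + 1) α (t⁻¹ * τ) := by
    intro τ
    by_cases h0 : 0 < τ
    · rw [indicator_of_mem (show τ ∈ Ioi (0 : ℝ) from h0)]
      by_cases h1 : τ < t
      · rw [ProbabilityTheory.betaPDF_of_pos_lt_one (by positivity)
          (by rwa [inv_mul_lt_iff₀ ht, mul_one]), timeKernel, if_pos (by linarith),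
          ← ENNReal.ofReal_mul (by have := sub_pos.2 h1; positivity), ← ENNReal.ofReal_mul hc0]
        congr 1
        have e1 : (1 - t⁻¹ * τ) = (t - τ) / t := by field_simp
        have e2 : t ^ (α + γ - 1) = t ^ γ * t ^ (α - 1) := by
          rw [← Real.rpow_add ht]; congr 1; ring
        rw [e1, inv_mul_eq_div, Real.div_rpow h0.le ht.le,
          Real.div_rpow (sub_pos.2 h1).le ht.le, hc, ProbabilityTheory.beta, e2,
          add_sub_cancel_right, show γ + 1 + α = α + γ + 1 by ring]
        field_simp
      · rw [ProbabilityTheory.betaPDF_eq_zero_of_one_le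
          (by rw [inv_mul_eq_div, le_div_iff₀ ht]; linarith), timeKernel,
          if_neg (by linarith)]
        simp
    · rw [indicator_of_notMem (by simpa using h0), ProbabilityTheory.betaPDF_eq_zero_of_nonpos
        (mul_nonpos_of_nonneg_of_nonpos (by positivity) (by linarith))]
      simp
  have hmeas' : Measurable fun τ => ProbabilityTheory.betaPDF (γ + 1) α (t⁻¹ * τ) :=
    hmeas.comp (measurable_const_mul _)
  rw [← lintegral_indicator measurableSet_Ioi, lintegral_congr key, lintegral_const_mul _ hmeas']
  have hscale : ∫⁻ τ, ProbabilityTheory.betaPDF (γ + 1) α (t⁻¹ * τ) = ENNReal.ofReal t := by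
    rw [← lintegral_map hmeas (measurable_const_mul t⁻¹),
      Real.map_volume_mul_left (by positivity), lintegral_smul_measure,
      ProbabilityTheory.lintegral_betaPDF_eq_one (by linarith) hα, inv_inv, abs_of_pos ht]
    simp
  rw [hscale, ← ENNReal.ofReal_mul hc0, hc, mul_assoc]
  congr 2
  rw [← Real.rpow_add_one ht.ne']
  congr 1
  ring

/-! ### Schur's test and boundedness from a gain of integrability -/

/-- Jensen's inequality for the measure `κ μ`, whose total mass need not be `1`. -/
theorem rpow_lintegral_mul_le {Ω : Type*} [MeasurableSpace Ω] {μ : Measure Ω}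
    {κ F : Ω → ℝ≥0∞} (hκ : Measurable κ) (hF : Measurable F) {r : ℝ} (hr : 1 ≤ r) :
    (∫⁻ w, κ w * F w ∂μ) ^ r ≤ (∫⁻ w, κ w ∂μ) ^ (r - 1) * ∫⁻ w, κ w * F w ^ r ∂μ := by
  rcases hr.eq_or_lt with rfl | hr1
  · simp
  have hr0 : 0 < r := by linarith
  have hconj : (r.conjExponent).HolderConjugate r := (Real.HolderConjugate.conjExponent hr1).symm
  set q := r.conjExponent with hq
  have hq0 : 0 < q := hconj.pos
  have hsum : q⁻¹ + r⁻¹ = 1 := by simpa using hconj.inv_add_inv_eq_one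
  have hol := ENNReal.lintegral_mul_le_Lp_mul_Lq μ hconj
    (f := fun w => κ w ^ q⁻¹) (g := fun w => κ w ^ r⁻¹ * F w)
    (hκ.pow_const _).aemeasurable ((hκ.pow_const _).mul hF).aemeasurable
  have e1 : ∀ w, ((fun w => κ w ^ q⁻¹) * fun w => κ w ^ r⁻¹ * F w) w = κ w * F w := by
    intro w
    simp only [Pi.mul_apply]
    rw [← mul_assoc, ← ENNReal.rpow_add_of_nonneg _ _ (by positivity) (by positivity), hsum,
      ENNReal.rpow_one]
  have e2 : ∀ w, (κ w ^ q⁻¹) ^ q = κ w := fun w => ENNReal.rpow_inv_rpow hq0.ne' _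
  have e3 : ∀ w, (κ w ^ r⁻¹ * F w) ^ r = κ w * F w ^ r := fun w => by
    rw [ENNReal.mul_rpow_of_nonneg _ _ hr0.le, ENNReal.rpow_inv_rpow hr0.ne']
  simp_rw [e1, e2, e3] at hol
  calc (∫⁻ w, κ w * F w ∂μ) ^ r
      ≤ ((∫⁻ w, κ w ∂μ) ^ (1 / q) * (∫⁻ w, κ w * F w ^ r ∂μ) ^ (1 / r)) ^ r :=
        ENNReal.rpow_le_rpow hol hr0.le
    _ = (∫⁻ w, κ w ∂μ) ^ (r - 1) * ∫⁻ w, κ w * F w ^ r ∂μ := by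
        rw [ENNReal.mul_rpow_of_nonneg _ _ hr0.le, ← ENNReal.rpow_mul, ← ENNReal.rpow_mul,
          one_div_mul_cancel hr0.ne', ENNReal.rpow_one]
        congr 2
        have : q⁻¹ = 1 - r⁻¹ := by linarith
        rw [one_div, this, sub_mul, inv_mul_cancel₀ hr0.ne', one_mul]

/-- Schur's test with equal bounds for rows and columns: the integral operator has norm at most
`A` on every `L^r` with `r ≥ 1`. -/
theorem lintegral_rpow_lintegral_mul_le {Ω : Type*} [MeasurableSpace Ω] {μ : Measure Ω} [SFinite μ]
    {κ : Ω → Ω → ℝ≥0∞} (hκ : Measurable (Function.uncurry κ)) {A : ℝ≥0∞}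
    (hrow : ∀ᵐ z ∂μ, ∫⁻ w, κ z w ∂μ ≤ A) (hcol : ∀ᵐ w ∂μ, ∫⁻ z, κ z w ∂μ ≤ A)
    {F : Ω → ℝ≥0∞} (hF : Measurable F) {r : ℝ} (hr : 1 ≤ r) :
    ∫⁻ z, (∫⁻ w, κ z w * F w ∂μ) ^ r ∂μ ≤ A ^ r * ∫⁻ w, F w ^ r ∂μ := by
  have hFr : Measurable fun w => F w ^ r := hF.pow_const r
  have hκF : Measurable (Function.uncurry fun z w => κ z w * F w ^ r) :=
    hκ.mul (hFr.comp measurable_snd)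
  calc ∫⁻ z, (∫⁻ w, κ z w * F w ∂μ) ^ r ∂μ
      ≤ ∫⁻ z, A ^ (r - 1) * ∫⁻ w, κ z w * F w ^ r ∂μ ∂μ := by
        refine lintegral_mono_ae (hrow.mono fun z hz => ?_)
        refine (rpow_lintegral_mul_le (hκ.comp measurable_prodMk_left) hF hr).trans ?_
        exact mul_le_mul_left (ENNReal.rpow_le_rpow hz (by linarith)) _
    _ = A ^ (r - 1) * ∫⁻ w, ∫⁻ z, κ z w * F w ^ r ∂μ ∂μ := by
        have hm : Measurable fun z => ∫⁻ w, κ z w * F w ^ r ∂μ := hκF.lintegral_prod_right'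
        rw [lintegral_const_mul _ hm, lintegral_lintegral_swap hκF.aemeasurable]
    _ ≤ A ^ (r - 1) * ∫⁻ w, A * F w ^ r ∂μ := by
        gcongr 1
        refine lintegral_mono_ae (hcol.mono fun w hw => ?_)
        have hm : Measurable fun z => κ z w := hκ.comp measurable_prodMk_right
        rw [lintegral_mul_const _ hm]
        gcongr
    _ = A ^ r * ∫⁻ w, F w ^ r ∂μ := by
        rw [lintegral_const_mul _ hFr, ← mul_assoc]
        congr 1
        nth_rewrite 2 [← ENNReal.rpow_one A]
        rw [← ENNReal.rpow_add_of_nonneg _ _ (by linarith) zero_le_one, sub_add_cancel]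

/-- By Fatou's lemma: where `H > 1`, the powers `H ^ s k` tend to infinity. -/
theorem ae_le_one_of_lintegral_rpow_bounded {Ω : Type*} [MeasurableSpace Ω] {μ : Measure Ω}
    {H : Ω → ℝ≥0∞} (hH : Measurable H) {s : ℕ → ℝ} (hs : Filter.Tendsto s Filter.atTop Filter.atTop)
    {I : ℝ≥0∞} (hI : I ≠ ∞) (hb : ∀ k, ∫⁻ z, H z ^ s k ∂μ ≤ I) : ∀ᵐ z ∂μ, H z ≤ 1 := by
  have hS : MeasurableSet {z | 1 < H z} := measurableSet_lt measurable_const hH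
  have hlim : ∀ᵐ z ∂μ.restrict {z | 1 < H z},
      ∞ ≤ Filter.liminf (fun k => H z ^ s k) Filter.atTop :=
    ae_restrict_of_forall_mem hS fun z hz =>
      (((ENNReal.tendsto_rpow_atTop_of_one_lt_base hz).comp hs).liminf_eq).ge
  have hle : ∞ * μ {z | 1 < H z} ≤ I := by
    calc ∞ * μ {z | 1 < H z}
        = ∫⁻ _ in {z | 1 < H z}, ∞ ∂μ := (setLIntegral_const _ _).symm
      _ ≤ ∫⁻ z in {z | 1 < H z}, Filter.liminf (fun k => H z ^ s k) Filter.atTop ∂μ :=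
        lintegral_mono_ae hlim
      _ ≤ Filter.liminf (fun k => ∫⁻ z in {z | 1 < H z}, H z ^ s k ∂μ) Filter.atTop :=
        lintegral_liminf_le fun k => hH.pow_const _
      _ ≤ I := Filter.liminf_le_of_frequently_le' (Filter.Frequently.of_forall fun k =>
        (setLIntegral_le_lintegral _ _).trans (hb k))
  have h0 : μ {z | 1 < H z} = 0 := by
    by_contra h
    rw [ENNReal.top_mul h, top_le_iff] at hle
    exact hI hle
  rw [ae_iff]
  simpa using h0

/-- If passing from the exponent `r` to `r / θ > r` costs only the factor `D ^ r`, then an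
`L^p` function is bounded. After division by `m = D ^ (θ / (1 - θ))`, the fixed point of
`m ↦ (D m) ^ θ`, the integrals of the powers `p / θ ^ k` do not increase with `k`. -/
theorem ae_le_of_lintegral_rpow_step {Ω : Type*} [MeasurableSpace Ω] {μ : Measure Ω}
    {F : Ω → ℝ≥0∞} (hF : Measurable F) {θ p : ℝ} (hθ : 0 < θ) (hθ1 : θ < 1) (hp : 1 ≤ p)
    {D : ℝ≥0∞} (hD0 : D ≠ 0) (hD : D ≠ ∞) (hFp : ∫⁻ z, F z ^ p ∂μ ≠ ∞)
    (hstep : ∀ r : ℝ, 1 ≤ r → ∫⁻ z, F z ^ (r / θ) ∂μ ≤ D ^ r * ∫⁻ z, F z ^ r ∂μ) :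
    ∀ᵐ z ∂μ, F z ≤ D ^ (θ / (1 - θ)) := by
  have h1θ : 0 < 1 - θ := sub_pos.2 hθ1
  set m := D ^ (θ / (1 - θ)) with hm
  have hm0 : m ≠ 0 := (ENNReal.rpow_pos (pos_iff_ne_zero.2 hD0) hD).ne'
  have hmt : m ≠ ∞ := ENNReal.rpow_ne_top_of_nonneg (by positivity) hD
  have hscale : ∀ r : ℝ, 0 ≤ r → ∫⁻ z, (F z / m) ^ r ∂μ = (∫⁻ z, F z ^ r ∂μ) / m ^ r := by
    intro r hr
    simp_rw [ENNReal.div_rpow_of_nonneg _ _ hr, div_eq_mul_inv]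
    rw [lintegral_mul_const _ (hF.pow_const r)]
  -- the choice of `m` cancels the factor `D ^ r` exactly
  have hmD : ∀ r, m ^ (r / θ) = D ^ r * m ^ r := by
    intro r
    rw [hm, ← ENNReal.rpow_mul, ← ENNReal.rpow_mul, ← ENNReal.rpow_add _ _ hD0 hD]
    congr 1
    field_simp
    ring
  have hdec : ∀ r, 1 ≤ r → ∫⁻ z, (F z / m) ^ (r / θ) ∂μ ≤ ∫⁻ z, (F z / m) ^ r ∂μ := by
    intro r hr
    have hr0 : 0 ≤ r := by linarith
    have hDr0 : D ^ r ≠ 0 := (ENNReal.rpow_pos (pos_iff_ne_zero.2 hD0) hD).ne'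
    have hDrt : D ^ r ≠ ∞ := ENNReal.rpow_ne_top_of_nonneg hr0 hD
    rw [hscale _ (by positivity), hscale _ hr0, hmD]
    refine (ENNReal.div_le_div_right (hstep r hr) _).trans_eq ?_
    rw [ENNReal.mul_div_mul_left _ _ hDr0 hDrt]
  have hge : ∀ k : ℕ, 1 ≤ p / θ ^ k := fun k =>
    (one_le_div (by positivity)).2 ((pow_le_one₀ hθ.le hθ1.le).trans hp)
  have hall : ∀ k : ℕ, ∫⁻ z, (F z / m) ^ (p / θ ^ k) ∂μ ≤ ∫⁻ z, (F z / m) ^ p ∂μ := by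
    intro k
    induction k with
    | zero => simp
    | succ k ih =>
      rw [pow_succ, ← div_div]
      exact (hdec _ (hge k)).trans ih
  have htend : Filter.Tendsto (fun k : ℕ => p / θ ^ k) Filter.atTop Filter.atTop := by
    simp_rw [div_eq_mul_inv, ← inv_pow]
    exact (tendsto_pow_atTop_atTop_of_one_lt ((one_lt_inv₀ hθ).2 hθ1)).const_mul_atTop
      (by linarith)
  have hfin : ∫⁻ z, (F z / m) ^ p ∂μ ≠ ∞ := by
    rw [hscale _ (by linarith)]
    exact ENNReal.div_ne_top hFp (ENNReal.rpow_pos (pos_iff_ne_zero.2 hm0) hmt).ne'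
  filter_upwards [ae_le_one_of_lintegral_rpow_bounded (hF.div_const m) htend hfin hall] with z hz
  rwa [ENNReal.div_le_iff hm0 hmt, one_mul] at hz

/-! ### The potential on strips -/

theorem measurable_kernel_sub (n : ℕ) (α : ℝ) :
    Measurable (Function.uncurry fun z w : EuclideanSpace ℝ (Fin n) × ℝ =>
      ENNReal.ofReal (kernel n α (z.1 - w.1) (z.2 - w.2))) :=
  ((measurable_kernel n α).comp (measurable_fst.sub measurable_snd)).ennreal_ofReal

theorem heatPotential_eq_strip {F : EuclideanSpace ℝ (Fin n) × ℝ → ℝ≥0∞}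
    (hF0 : ∀ w, w.2 ≤ 0 → F w = 0) {T : ℝ} {z : EuclideanSpace ℝ (Fin n) × ℝ} (hz : z.2 ≤ T) :
    heatPotential n α F z = ∫⁻ w in univ ×ˢ Ioo 0 T,
      ENNReal.ofReal (kernel n α (z.1 - w.1) (z.2 - w.2)) * F w := by
  rw [heatPotential, ← lintegral_indicator (MeasurableSet.univ.prod measurableSet_Ioo)]
  refine lintegral_congr fun w => ?_
  by_cases hw : w ∈ (univ ×ˢ Ioo 0 T : Set (EuclideanSpace ℝ (Fin n) × ℝ))
  · rw [indicator_of_mem hw]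
  · rw [indicator_of_notMem hw]
    by_cases h0 : w.2 ≤ 0
    · rw [hF0 w h0, mul_zero]
    · have hT : T ≤ w.2 := by
        by_contra h
        exact hw ⟨mem_univ _, not_le.1 h0, not_le.1 h⟩
      rw [kernel, if_neg (by linarith), ENNReal.ofReal_zero, zero_mul]

theorem heatPotential_timePower (hα : 0 < α) {γ : ℝ} (hγ : 0 ≤ γ)
    {z : EuclideanSpace ℝ (Fin n) × ℝ} (hz : 0 < z.2) :
    heatPotential n α (fun w => timePower γ w.2) z =
      ENNReal.ofReal (gammaRatio α γ * z.2 ^ (α + γ)) := by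
  rw [heatPotential_comp_snd hα (measurable_timePower γ), gammaRatio,
    ← lintegral_timeKernel_mul_rpow hα hγ hz, ← lintegral_indicator measurableSet_Ioi]
  refine lintegral_congr fun τ => ?_
  rw [indicator_mul_right, timePower]

theorem setLIntegral_kernel_sub_le (hα : 0 < α) {T : ℝ} {z : EuclideanSpace ℝ (Fin n) × ℝ}
    (hz : z.2 ∈ Ioo 0 T) :
    ∫⁻ w in univ ×ˢ Ioo 0 T, ENNReal.ofReal (kernel n α (z.1 - w.1) (z.2 - w.2)) ≤
      ENNReal.ofReal (T ^ α / Real.Gamma (α + 1)) := by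
  have h := heatPotential_timePower (n := n) hα le_rfl hz.1
  simp only [gammaRatio, zero_add, add_zero, Real.Gamma_one, one_div_mul_eq_div] at h
  have hΓ := Real.Gamma_pos_of_pos (show 0 < α + 1 by linarith)
  calc ∫⁻ w in univ ×ˢ Ioo 0 T, ENNReal.ofReal (kernel n α (z.1 - w.1) (z.2 - w.2))
      ≤ heatPotential n α (fun w => timePower 0 w.2) z := by
        rw [← lintegral_indicator (MeasurableSet.univ.prod measurableSet_Ioo), heatPotential]
        refine lintegral_mono fun w => ?_
        by_cases hw : w ∈ (univ ×ˢ Ioo 0 T : Set (EuclideanSpace ℝ (Fin n) × ℝ))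
        · simp only
          rw [indicator_of_mem hw, timePower_of_pos hw.2.1, Real.rpow_zero, ENNReal.ofReal_one,
            mul_one]
        · simp only
          rw [indicator_of_notMem hw]
          exact zero_le
    _ = ENNReal.ofReal (z.2 ^ α / Real.Gamma (α + 1)) := h
    _ ≤ ENNReal.ofReal (T ^ α / Real.Gamma (α + 1)) := by
        gcongr
        · exact hz.1.le
        · exact hz.2.le

/-- The integral in the first variable: the reflection `z ↦ (0, T) - z` preserves the strip and
turns it into an integral in the second variable. -/
theorem setLIntegral_kernel_sub_le' (hα : 0 < α) {T : ℝ} {w : EuclideanSpace ℝ (Fin n) × ℝ}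
    (hw : w.2 ∈ Ioo 0 T) :
    ∫⁻ z in univ ×ˢ Ioo 0 T, ENNReal.ofReal (kernel n α (z.1 - w.1) (z.2 - w.2)) ≤
      ENNReal.ofReal (T ^ α / Real.Gamma (α + 1)) := by
  have : (volume : Measure (EuclideanSpace ℝ (Fin n) × ℝ)).IsAddHaarMeasure := by
    rw [Measure.volume_eq_prod]
    infer_instance
  refine le_of_eq_of_le ?_ (setLIntegral_kernel_sub_le (n := n) (z := (-w.1, T - w.2)) hα
    ⟨by simpa using hw.2, by simpa using hw.1⟩)
  rw [← lintegral_indicator (MeasurableSet.univ.prod measurableSet_Ioo),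
    ← lintegral_indicator (MeasurableSet.univ.prod measurableSet_Ioo),
    ← lintegral_sub_left_eq_self _ ((0, T) : EuclideanSpace ℝ (Fin n) × ℝ)]
  refine lintegral_congr fun z => ?_
  have hmem : (0, T) - z ∈ (univ ×ˢ Ioo 0 T : Set (EuclideanSpace ℝ (Fin n) × ℝ)) ↔
      z ∈ (univ ×ˢ Ioo 0 T : Set (EuclideanSpace ℝ (Fin n) × ℝ)) := by
    simp [and_comm]
  by_cases hz : z ∈ (univ ×ˢ Ioo 0 T : Set (EuclideanSpace ℝ (Fin n) × ℝ))
  · rw [indicator_of_mem hz, indicator_of_mem (hmem.2 hz)]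
    congr 2
    · simp only [Prod.fst_sub]; abel
    · simp only [Prod.snd_sub]; abel
  · rw [indicator_of_notMem hz, indicator_of_notMem (hmem.not.2 hz)]

/-- `J_α` is bounded on `L^r(ℝⁿ × (0, T))`, with norm at most `T^α / Γ(α+1)`, for every `r ≥ 1`. -/
theorem lintegral_heatPotential_rpow_le (hα : 0 < α)
    {F : EuclideanSpace ℝ (Fin n) × ℝ → ℝ≥0∞} (hF : Measurable F)
    (hF0 : ∀ w, w.2 ≤ 0 → F w = 0) {r : ℝ} (hr : 1 ≤ r) (T : ℝ) :
    ∫⁻ z in univ ×ˢ Ioo 0 T, heatPotential n α F z ^ r ≤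
      ENNReal.ofReal (T ^ α / Real.Gamma (α + 1)) ^ r * ∫⁻ w in univ ×ˢ Ioo 0 T, F w ^ r := by
  have hS : MeasurableSet (univ ×ˢ Ioo 0 T : Set (EuclideanSpace ℝ (Fin n) × ℝ)) :=
    MeasurableSet.univ.prod measurableSet_Ioo
  refine le_of_eq_of_le (setLIntegral_congr_fun hS fun z hz => ?_)
    (lintegral_rpow_lintegral_mul_le (measurable_kernel_sub n α)
      (ae_restrict_of_forall_mem hS fun z hz => setLIntegral_kernel_sub_le hα hz.2)
      (ae_restrict_of_forall_mem hS fun w hw => setLIntegral_kernel_sub_le' hα hw.2) hF hr)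
  rw [heatPotential_eq_strip hF0 hz.2.2.le]

theorem heatPotential_le_timePower (hα : 0 < α) {γ : ℝ} (hγ : 0 ≤ γ)
    {F : EuclideanSpace ℝ (Fin n) × ℝ → ℝ≥0∞} {c : ℝ≥0∞}
    (hF : ∀ᵐ w, F w ≤ c * timePower γ w.2) (z : EuclideanSpace ℝ (Fin n) × ℝ) :
    heatPotential n α F z ≤ c * ENNReal.ofReal (gammaRatio α γ) * timePower (α + γ) z.2 := by
  rcases lt_or_ge 0 z.2 with hz | hz
  · have hm : Measurable fun w : EuclideanSpace ℝ (Fin n) × ℝ =>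
        ENNReal.ofReal (kernel n α (z.1 - w.1) (z.2 - w.2)) * timePower γ w.2 := by
      exact ((measurable_kernel_sub n α).comp measurable_prodMk_left).mul
        ((measurable_timePower γ).comp measurable_snd)
    calc heatPotential n α F z
        ≤ ∫⁻ w : EuclideanSpace ℝ (Fin n) × ℝ,
            c * (ENNReal.ofReal (kernel n α (z.1 - w.1) (z.2 - w.2)) * timePower γ w.2) := by
          refine lintegral_mono_ae (hF.mono fun w hw => ?_)
          rw [mul_left_comm]
          gcongr
      _ = c * heatPotential n α (fun w => timePower γ w.2) z := by
          rw [heatPotential, lintegral_const_mul _ hm]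
      _ = c * ENNReal.ofReal (gammaRatio α γ) * timePower (α + γ) z.2 := by
          rw [heatPotential_timePower hα hγ hz, timePower_of_pos hz, mul_assoc,
            ← ENNReal.ofReal_mul (gammaRatio_pos hα hγ).le]
  · have h0 : heatPotential n α F z = ∫⁻ w : EuclideanSpace ℝ (Fin n) × ℝ, 0 := by
      refine lintegral_congr_ae (hF.mono fun w hw => ?_)
      simp only
      rcases lt_or_ge 0 w.2 with hw0 | hw0
      · rw [kernel, if_neg (by linarith), ENNReal.ofReal_zero, zero_mul]
      · rw [timePower_of_nonpos hw0, mul_zero, nonpos_iff_eq_zero] at hw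
        rw [hw, mul_zero]
    rw [h0, lintegral_zero]
    exact zero_le

/-! ### Boundedness of the densities -/

/-- Bounds on all strips with constants `c * T ^ γ` combine into one pointwise bound: rational
`T` suffice, so that only countably many null sets are discarded. -/
theorem ae_le_timePower_of_strips {F : EuclideanSpace ℝ (Fin n) × ℝ → ℝ≥0∞}
    (hF0 : ∀ w, w.2 ≤ 0 → F w = 0) {c γ : ℝ} (hc : 0 ≤ c)
    (hF : ∀ T : ℝ, 0 < T →
      ∀ᵐ z ∂volume.restrict (univ ×ˢ Ioo 0 T : Set (EuclideanSpace ℝ (Fin n) × ℝ)),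
        F z ≤ ENNReal.ofReal (c * T ^ γ)) :
    ∀ᵐ z, F z ≤ ENNReal.ofReal c * timePower γ z.2 := by
  have hq : ∀ᵐ z : EuclideanSpace ℝ (Fin n) × ℝ, ∀ T : ℚ, z ∈ univ ×ˢ Ioo 0 (T : ℝ) →
      F z ≤ ENNReal.ofReal (c * (T : ℝ) ^ γ) := by
    refine ae_all_iff.2 fun T => ?_
    rw [← ae_restrict_iff'₀ (MeasurableSet.univ.prod measurableSet_Ioo).nullMeasurableSet]
    rcases lt_or_ge 0 (T : ℝ) with hT | hT
    · exact hF T hT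
    · simp [Ioo_eq_empty (not_lt.2 hT)]
  filter_upwards [hq] with z hz
  rcases lt_or_ge 0 z.2 with ht | ht
  · rw [timePower_of_pos ht, ← ENNReal.ofReal_mul hc]
    by_contra! hlt
    have hcont : ContinuousAt (fun s : ℝ => ENNReal.ofReal (c * s ^ γ)) z.2 :=
      ENNReal.continuous_ofReal.continuousAt.comp
        (continuousAt_const.mul (Real.continuousAt_rpow_const _ _ (Or.inl ht.ne')))
    have hev : ∀ᶠ s in nhdsWithin z.2 (Ioi z.2), ENNReal.ofReal (c * s ^ γ) < F z :=
      (hcont.eventually_lt_const hlt).filter_mono nhdsWithin_le_nhds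
    obtain ⟨b, hb, hsub⟩ := mem_nhdsGT_iff_exists_Ioo_subset.1 hev
    obtain ⟨T, hT1, hT2⟩ := exists_rat_btwn (mem_Ioi.1 hb)
    exact (hz T ⟨mem_univ _, ht, hT1⟩).not_gt (hsub ⟨hT1, hT2⟩)
  · rw [hF0 z ht]
    exact zero_le

/-- For `σ ≤ 1`, the pair of inequalities takes `F` from `L^r` to `L^(r / (λσ))` on the strip, for
every `r ≥ 1`; the condition `σ ≤ 1` keeps the intermediate exponent `r / σ` at least `1`, where
`J_β` is bounded. As `λσ < 1`, the exponents increase to infinity. -/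
theorem ae_le_on_strip {F G : EuclideanSpace ℝ (Fin n) × ℝ → ℝ≥0∞} {lam σ p : ℝ}
    (hα : 0 < α) (hβ : 0 < β) (hlam : 0 < lam) (hσ : 0 < σ) (hσ1 : σ ≤ 1) (hθ : lam * σ < 1)
    (hp : 1 ≤ p) (hF : Measurable F) (hG : Measurable G)
    (hF0 : ∀ w, w.2 ≤ 0 → F w = 0) (hG0 : ∀ w, w.2 ≤ 0 → G w = 0)
    (hFG : ∀ᵐ z, F z ≤ heatPotential n β G z ^ lam)
    (hGF : ∀ᵐ z, G z ≤ heatPotential n α F z ^ σ) {T : ℝ} (hT : 0 < T)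
    (hFp : ∫⁻ z in univ ×ˢ Ioo 0 T, F z ^ p ≠ ∞) :
    ∀ᵐ z ∂volume.restrict (univ ×ˢ Ioo 0 T : Set (EuclideanSpace ℝ (Fin n) × ℝ)),
      F z ≤ (ENNReal.ofReal (T ^ β / Real.Gamma (β + 1)) ^ (1 / σ) *
        ENNReal.ofReal (T ^ α / Real.Gamma (α + 1))) ^ (lam * σ / (1 - lam * σ)) := by
  have hΓα := Real.Gamma_pos_of_pos (show 0 < α + 1 by linarith)
  have hΓβ := Real.Gamma_pos_of_pos (show 0 < β + 1 by linarith)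
  set A := ENNReal.ofReal (T ^ α / Real.Gamma (α + 1)) with hA
  set B := ENNReal.ofReal (T ^ β / Real.Gamma (β + 1)) with hB
  have hA0 : A ≠ 0 := (ENNReal.ofReal_pos.2 (by positivity)).ne'
  have hB0 : B ^ (1 / σ) ≠ 0 :=
    (ENNReal.rpow_pos (ENNReal.ofReal_pos.2 (by positivity)) ENNReal.ofReal_ne_top).ne'
  refine ae_le_of_lintegral_rpow_step hF (by positivity) hθ hp (mul_ne_zero hB0 hA0)
    (ENNReal.mul_ne_top (ENNReal.rpow_ne_top_of_nonneg (by positivity) ENNReal.ofReal_ne_top)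
      ENNReal.ofReal_ne_top) hFp fun r hr => ?_
  have hr0 : 0 < r := by linarith
  have hrσ : 1 ≤ r / σ := (one_le_div hσ).2 (hσ1.trans hr)
  calc ∫⁻ z in univ ×ˢ Ioo 0 T, F z ^ (r / (lam * σ))
      ≤ ∫⁻ z in univ ×ˢ Ioo 0 T, heatPotential n β G z ^ (r / σ) := by
        refine lintegral_mono_ae (ae_restrict_of_ae (hFG.mono fun z hz => ?_))
        refine (ENNReal.rpow_le_rpow hz (by positivity)).trans_eq ?_
        rw [← ENNReal.rpow_mul]
        congr 1
        field_simp
    _ ≤ B ^ (r / σ) * ∫⁻ z in univ ×ˢ Ioo 0 T, G z ^ (r / σ) :=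
        lintegral_heatPotential_rpow_le hβ hG hG0 hrσ T
    _ ≤ B ^ (r / σ) * ∫⁻ z in univ ×ˢ Ioo 0 T, heatPotential n α F z ^ r := by
        gcongr 1
        refine lintegral_mono_ae (ae_restrict_of_ae (hGF.mono fun z hz => ?_))
        refine (ENNReal.rpow_le_rpow hz (by positivity)).trans_eq ?_
        rw [← ENNReal.rpow_mul, mul_div_cancel₀ _ hσ.ne']
    _ ≤ B ^ (r / σ) * (A ^ r * ∫⁻ z in univ ×ˢ Ioo 0 T, F z ^ r) := by
        gcongr 1
        exact lintegral_heatPotential_rpow_le hα hF hF0 hr T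
    _ = (B ^ (1 / σ) * A) ^ r * ∫⁻ z in univ ×ˢ Ioo 0 T, F z ^ r := by
        rw [ENNReal.mul_rpow_of_nonneg _ _ hr0.le, ← ENNReal.rpow_mul, one_div_mul_eq_div,
          mul_assoc]

theorem gamma₁_nonneg {lam σ : ℝ} (hα : 0 < α) (hβ : 0 < β) (hlam : 0 < lam) (hσ : 0 < σ)
    (hθ : lam * σ < 1) : 0 ≤ gamma₁ lam σ α β := by
  have := sub_pos.2 hθ
  unfold gamma₁
  positivity

/-- The bound on strips has the scaling exponent `γ₁` in `T`, though not the sharp constant. -/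
theorem exists_ae_le_timePower {F G : EuclideanSpace ℝ (Fin n) × ℝ → ℝ≥0∞} {lam σ p : ℝ}
    (hα : 0 < α) (hβ : 0 < β) (hlam : 0 < lam) (hσ : 0 < σ) (hσ1 : σ ≤ 1) (hθ : lam * σ < 1)
    (hp : 1 ≤ p) (hF : Measurable F) (hG : Measurable G)
    (hF0 : ∀ w, w.2 ≤ 0 → F w = 0) (hG0 : ∀ w, w.2 ≤ 0 → G w = 0)
    (hFG : ∀ᵐ z, F z ≤ heatPotential n β G z ^ lam)
    (hGF : ∀ᵐ z, G z ≤ heatPotential n α F z ^ σ)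
    (hFp : ∀ T : ℝ, ∫⁻ z in univ ×ˢ Ioo 0 T, F z ^ p ≠ ∞) :
    ∃ c : ℝ≥0∞, c ≠ ∞ ∧ ∀ᵐ z, F z ≤ c * timePower (gamma₁ lam σ α β) z.2 := by
  have hΓα := Real.Gamma_pos_of_pos (show 0 < α + 1 by linarith)
  have hΓβ := Real.Gamma_pos_of_pos (show 0 < β + 1 by linarith)
  have h1θ : 0 < 1 - lam * σ := sub_pos.2 hθ
  set e := lam * σ / (1 - lam * σ) with he
  have he0 : 0 ≤ e := by positivity
  set c : ℝ := ((1 / Real.Gamma (β + 1)) ^ (1 / σ) * (1 / Real.Gamma (α + 1))) ^ e with hc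
  refine ⟨ENNReal.ofReal c, ENNReal.ofReal_ne_top,
    ae_le_timePower_of_strips hF0 (by positivity) fun T hT => ?_⟩
  filter_upwards [ae_le_on_strip hα hβ hlam hσ hσ1 hθ hp hF hG hF0 hG0 hFG hGF hT (hFp T)]
    with z hz
  refine hz.trans_eq ?_
  rw [ENNReal.ofReal_rpow_of_nonneg (by positivity) (by positivity),
    ← ENNReal.ofReal_mul (by positivity), ENNReal.ofReal_rpow_of_nonneg (by positivity) he0]
  congr 1
  rw [hc, div_eq_mul_one_div (T ^ β), div_eq_mul_one_div (T ^ α),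
    Real.mul_rpow (x := T ^ β) (by positivity) (by positivity), mul_mul_mul_comm,
    Real.mul_rpow (by positivity) (by positivity), mul_comm, ← Real.rpow_mul hT.le,
    ← Real.rpow_add hT, ← Real.rpow_mul hT.le]
  congr 2
  rw [he, gamma₁]
  field_simp

/-! ### Sharp constants -/

theorem le_rpow_of_le_mul_rpow {a K : ℝ≥0∞} {θ : ℝ} (ha : a ≠ ∞) (hθ1 : θ < 1)
    (h : a ≤ K * a ^ θ) : a ≤ K ^ (1 / (1 - θ)) := by
  rcases eq_or_ne a 0 with rfl | ha0
  · exact zero_le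
  have h1θ : 0 < 1 - θ := sub_pos.2 hθ1
  rw [one_div, ENNReal.le_rpow_inv_iff h1θ, ENNReal.rpow_sub _ _ ha0 ha, ENNReal.rpow_one]
  exact ENNReal.div_le_of_le_mul h

theorem M₂_eq {lam σ : ℝ} (hα : 0 < α) (h₁ : 0 ≤ gamma₁ lam σ α β) :
    M₂ lam σ α β = gammaRatio β (gamma₂ lam σ α β) *
      gammaRatio α (gamma₁ lam σ α β) ^ (1 / lam) := by
  rw [M₂, gammaRatio, gammaRatio, Real.div_rpow (Real.Gamma_pos_of_pos (by linarith)).le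
    (Real.Gamma_pos_of_pos (by linarith)).le, div_mul_div_comm]

theorem gamma₁_swap (lam σ α β : ℝ) : gamma₁ σ lam β α = gamma₂ lam σ α β := by
  rw [gamma₁, gamma₂, mul_comm lam σ]

theorem gamma₂_swap (lam σ α β : ℝ) : gamma₂ σ lam β α = gamma₁ lam σ α β :=
  (gamma₁_swap σ lam β α).symm

theorem M₁_swap (lam σ α β : ℝ) : M₁ σ lam β α = M₂ lam σ α β := by
  rw [M₁, M₂, gamma₁_swap lam σ α β, gamma₂_swap lam σ α β]

theorem M₂_swap (lam σ α β : ℝ) : M₂ σ lam β α = M₁ lam σ α β := (M₁_swap σ lam β α).symm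

/-- The sharp constants, from any finite one: the least `a` with `F ≤ a t^γ₁` reproduces itself,
`a ≤ K a^(λσ)`, when it is sent through both inequalities, whence `a ≤ K^(1/(1-λσ))`. -/
theorem heatPotential_le_of_ae_le {F G : EuclideanSpace ℝ (Fin n) × ℝ → ℝ≥0∞} {lam σ : ℝ}
    (hα : 0 < α) (hβ : 0 < β) (hlam : 0 < lam) (hσ : 0 < σ) (hθ : lam * σ < 1)
    (hF0 : ∀ w, w.2 ≤ 0 → F w = 0)
    (hFG : ∀ᵐ z, F z ≤ heatPotential n β G z ^ lam)
    (hGF : ∀ᵐ z, G z ≤ heatPotential n α F z ^ σ) {c : ℝ≥0∞} (hc : c ≠ ∞)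
    (hFc : ∀ᵐ z, F z ≤ c * timePower (gamma₁ lam σ α β) z.2)
    (z : EuclideanSpace ℝ (Fin n) × ℝ) :
    heatPotential n α F z ≤ ENNReal.ofReal (M₂ lam σ α β ^ (lam / (1 - lam * σ))) *
        timePower (gamma₂ lam σ α β / σ) z.2 ∧
      heatPotential n β G z ≤ ENNReal.ofReal (M₁ lam σ α β ^ (σ / (1 - lam * σ))) *
        timePower (gamma₁ lam σ α β / lam) z.2 := by
  have h1θ : 0 < 1 - lam * σ := sub_pos.2 hθ
  have h₁ : 0 ≤ gamma₁ lam σ α β := gamma₁_nonneg hα hβ hlam hσ hθ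
  have h₂ : 0 ≤ gamma₂ lam σ α β := by
    rw [← gamma₁_swap]
    exact gamma₁_nonneg hβ hα hσ hlam (by rwa [mul_comm])
  have hM₂ := M₂_eq (lam := lam) (σ := σ) (β := β) hα h₁
  have hM₁ := M₂_eq (lam := σ) (σ := lam) (α := β) (β := α) hβ (by rwa [gamma₁_swap])
  rw [M₂_swap, gamma₁_swap, gamma₂_swap] at hM₁
  set γ₁ := gamma₁ lam σ α β with hγ₁
  set γ₂ := gamma₂ lam σ α β with hγ₂
  have k₁ : γ₁ * (1 - lam * σ) = (β + α * σ) * lam := div_mul_cancel₀ _ h1θ.ne'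
  have k₂ : γ₂ * (1 - lam * σ) = (α + β * lam) * σ := div_mul_cancel₀ _ h1θ.ne'
  -- the exponents are consistent: a round trip through both inequalities reproduces `γ₁`
  have e₁ : α + γ₁ = γ₂ / σ := by
    rw [eq_div_iff hσ.ne']
    exact mul_right_cancel₀ h1θ.ne' (by linear_combination σ * k₁ - k₂)
  have e₂ : β + γ₂ = γ₁ / lam := by
    rw [eq_div_iff hlam.ne']
    exact mul_right_cancel₀ h1θ.ne' (by linear_combination lam * k₂ - k₁)
  set g₁ := gammaRatio α γ₁ with hg₁
  set g₂ := gammaRatio β γ₂ with hg₂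
  have hg₁0 : 0 < g₁ := gammaRatio_pos hα h₁
  have hg₂0 : 0 < g₂ := gammaRatio_pos hβ h₂
  have step : ∀ a : ℝ≥0∞, (∀ᵐ z, F z ≤ a * timePower γ₁ z.2) →
      (∀ z, heatPotential n α F z ≤ a * ENNReal.ofReal g₁ * timePower (γ₂ / σ) z.2) ∧
      ∀ z, heatPotential n β G z ≤
        (a * ENNReal.ofReal g₁) ^ σ * ENNReal.ofReal g₂ * timePower (γ₁ / lam) z.2 := by
    intro a ha
    have hu := heatPotential_le_timePower hα h₁ ha
    rw [e₁] at hu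
    refine ⟨hu, ?_⟩
    rw [← e₂]
    refine heatPotential_le_timePower hβ h₂ (hGF.mono fun w hw => hw.trans ?_)
    refine (ENNReal.rpow_le_rpow (hu w) hσ.le).trans_eq ?_
    rw [ENNReal.mul_rpow_of_nonneg _ _ hσ.le, timePower_rpow hσ, div_mul_cancel₀ _ hσ.ne']
  set S : Set (EuclideanSpace ℝ (Fin n) × ℝ) := univ ×ˢ Ioi 0 with hS
  have hSm : MeasurableSet S := MeasurableSet.univ.prod measurableSet_Ioi
  have hdiv : ∀ w ∈ S, ∀ b : ℝ≥0∞, F w / timePower γ₁ w.2 ≤ b ↔ F w ≤ b * timePower γ₁ w.2 := by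
    intro w hw b
    have hw0 : 0 < w.2 := hw.2
    rw [timePower_of_pos hw0]
    exact ENNReal.div_le_iff (ENNReal.ofReal_pos.2 (by positivity)).ne' ENNReal.ofReal_ne_top
  -- the least constant in `F ≤ a t^γ₁`
  set a := essSup (fun w => F w / timePower γ₁ w.2) (volume.restrict S) with ha
  have hmin : ∀ b : ℝ≥0∞, (∀ᵐ w, F w ≤ b * timePower γ₁ w.2) → a ≤ b := fun b hb =>
    essSup_le_of_ae_le _ ((ae_restrict_iff' hSm).2 (hb.mono fun w hw hwS => (hdiv w hwS b).2 hw))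
  have hFa : ∀ᵐ w, F w ≤ a * timePower γ₁ w.2 := by
    filter_upwards [(ae_restrict_iff' hSm).1
      (ENNReal.ae_le_essSup (μ := volume.restrict S) fun w => F w / timePower γ₁ w.2)] with w hw
    rcases lt_or_ge 0 w.2 with h | h
    · exact (hdiv w ⟨mem_univ _, h⟩ a).1 (hw ⟨mem_univ _, h⟩)
    · rw [hF0 w h]
      exact zero_le
  -- needed below, since `a = ∞` satisfies `a ≤ K a^(λσ)` as well
  have hat : a ≠ ∞ := ne_top_of_le_ne_top hc (hmin c hFc)
  have hKa : a ≤ ENNReal.ofReal ((g₁ ^ σ * g₂) ^ lam) * a ^ (lam * σ) := by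
    refine hmin _ (hFG.mono fun w hw => hw.trans ?_)
    refine (ENNReal.rpow_le_rpow ((step a hFa).2 w) hlam.le).trans_eq ?_
    rw [ENNReal.mul_rpow_of_nonneg _ _ hlam.le, timePower_rpow hlam, div_mul_cancel₀ _ hlam.ne',
      ENNReal.mul_rpow_of_nonneg _ _ hσ.le, mul_assoc, ENNReal.mul_rpow_of_nonneg _ _ hlam.le,
      ← ENNReal.rpow_mul, mul_comm σ lam, ENNReal.ofReal_rpow_of_nonneg hg₁0.le hσ.le,
      ← ENNReal.ofReal_mul (by positivity),
      ENNReal.ofReal_rpow_of_nonneg (by positivity) hlam.le]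
    congr 1
    exact mul_comm _ _
  set K := ((g₁ ^ σ * g₂) ^ lam) ^ (1 / (1 - lam * σ)) with hK
  have hK0 : 0 < K := by positivity
  have haK : a ≤ ENNReal.ofReal K := by
    have := le_rpow_of_le_mul_rpow hat hθ hKa
    rwa [ENNReal.ofReal_rpow_of_nonneg (by positivity) (by positivity)] at this
  have hFK : ∀ᵐ w, F w ≤ ENNReal.ofReal K * timePower γ₁ w.2 :=
    hFa.mono fun w hw => hw.trans (by gcongr)
  have hKg : K = g₁ ^ (lam * σ / (1 - lam * σ)) * g₂ ^ (lam / (1 - lam * σ)) := by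
    rw [hK, ← Real.rpow_mul (by positivity), Real.mul_rpow (by positivity) (by positivity),
      ← Real.rpow_mul hg₁0.le]
    congr 2 <;> ring
  -- the constants for `J_α F` and `J_β G` are the stated ones
  have c₂ : K * g₁ = M₂ lam σ α β ^ (lam / (1 - lam * σ)) := by
    rw [hM₂, Real.mul_rpow (by positivity) (by positivity), ← Real.rpow_mul hg₁0.le, hKg,
      mul_right_comm, ← Real.rpow_add_one hg₁0.ne', mul_comm]
    congr 2
    field_simp
    ring
  have c₁ : (K * g₁) ^ σ * g₂ = M₁ lam σ α β ^ (σ / (1 - lam * σ)) := by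
    calc (K * g₁) ^ σ * g₂
        = (g₁ ^ (lam * σ / (1 - lam * σ) + 1)) ^ σ *
            ((g₂ ^ (lam / (1 - lam * σ))) ^ σ * g₂) := by
          rw [hKg, mul_right_comm, ← Real.rpow_add_one hg₁0.ne',
            Real.mul_rpow (by positivity) (by positivity), mul_assoc]
      _ = g₁ ^ (σ / (1 - lam * σ)) * (g₂ ^ (1 / σ)) ^ (σ / (1 - lam * σ)) := by
          rw [← Real.rpow_mul hg₁0.le, ← Real.rpow_mul hg₂0.le, ← Real.rpow_mul hg₂0.le,
            ← Real.rpow_add_one hg₂0.ne']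
          congr 2 <;> field_simp <;> ring
      _ = M₁ lam σ α β ^ (σ / (1 - lam * σ)) := by
          rw [hM₁, Real.mul_rpow (by positivity) (by positivity)]
  have hfin := step _ hFK
  rw [← ENNReal.ofReal_mul hK0.le, ENNReal.ofReal_rpow_of_nonneg (by positivity) hσ.le,
    ← ENNReal.ofReal_mul (by positivity), c₁, c₂] at hfin
  exact ⟨hfin.1 z, hfin.2 z⟩

/-- The sharp bounds for the `ℝ≥0∞`-valued system. Since `λσ < 1`, one of `λ`, `σ` is at most `1`,
and the statement is symmetric under exchange of the two inequalities. -/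
theorem heatPotential_le_of_sublinear {F G : EuclideanSpace ℝ (Fin n) × ℝ → ℝ≥0∞}
    {lam σ p q : ℝ}
    (hα : 0 < α) (hβ : 0 < β) (hlam : 0 < lam) (hσ : 0 < σ) (hθ : lam * σ < 1)
    (hp : 1 ≤ p) (hq : 1 ≤ q) (hF : Measurable F) (hG : Measurable G)
    (hF0 : ∀ w, w.2 ≤ 0 → F w = 0) (hG0 : ∀ w, w.2 ≤ 0 → G w = 0)
    (hFG : ∀ᵐ z, F z ≤ heatPotential n β G z ^ lam)
    (hGF : ∀ᵐ z, G z ≤ heatPotential n α F z ^ σ)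
    (hFp : ∀ T : ℝ, ∫⁻ z in univ ×ˢ Ioo 0 T, F z ^ p ≠ ∞)
    (hGq : ∀ T : ℝ, ∫⁻ z in univ ×ˢ Ioo 0 T, G z ^ q ≠ ∞)
    (z : EuclideanSpace ℝ (Fin n) × ℝ) :
    heatPotential n α F z ≤ ENNReal.ofReal (M₂ lam σ α β ^ (lam / (1 - lam * σ))) *
        timePower (gamma₂ lam σ α β / σ) z.2 ∧
      heatPotential n β G z ≤ ENNReal.ofReal (M₁ lam σ α β ^ (σ / (1 - lam * σ))) *
        timePower (gamma₁ lam σ α β / lam) z.2 := by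
  rcases le_or_gt σ 1 with hσ1 | hσ1
  · obtain ⟨c, hc, hFc⟩ :=
      exists_ae_le_timePower hα hβ hlam hσ hσ1 hθ hp hF hG hF0 hG0 hFG hGF hFp
    exact heatPotential_le_of_ae_le hα hβ hlam hσ hθ hF0 hFG hGF hc hFc z
  · have hlam1 : lam ≤ 1 := by nlinarith
    have hθ' : σ * lam < 1 := by rwa [mul_comm]
    obtain ⟨c, hc, hGc⟩ :=
      exists_ae_le_timePower hβ hα hσ hlam hlam1 hθ' hq hG hF hG0 hF0 hGF hFG hGq
    have h := heatPotential_le_of_ae_le hβ hα hσ hlam hθ' hG0 hGF hFG hc hGc z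
    rw [M₁_swap, M₂_swap, gamma₁_swap, gamma₂_swap, mul_comm σ lam] at h
    exact h.symm

/-! ### Passage from real-valued functions to densities -/

/-- No integrability is required: a divergent integral gives `J = 0` on the left. -/
theorem enorm_J_le (hα : 0 < α) {f : EuclideanSpace ℝ (Fin n) × ℝ → ℝ}
    (hf : ∀ᵐ w, 0 ≤ f w) (z : EuclideanSpace ℝ (Fin n) × ℝ) :
    ‖J n α f z‖ₑ ≤ heatPotential n α (fun w => ENNReal.ofReal (f w)) z := by
  refine (enorm_integral_le_lintegral_enorm _).trans ((setLIntegral_le_lintegral _ _).trans ?_)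
  refine lintegral_mono_ae (hf.mono fun w hw => ?_)
  have hk := kernel_nonneg hα (z.1 - w.1) (z.2 - w.2)
  rw [Real.enorm_of_nonneg (mul_nonneg hk hw), ENNReal.ofReal_mul hk]

theorem heatPotential_congr_ae {F G : EuclideanSpace ℝ (Fin n) × ℝ → ℝ≥0∞} (h : F =ᵐ[volume] G)
    (z : EuclideanSpace ℝ (Fin n) × ℝ) : heatPotential n α F z = heatPotential n α G z :=
  lintegral_congr_ae (h.mono fun w hw => by simp only [hw])

theorem ae_snd_ne_zero : ∀ᵐ z : EuclideanSpace ℝ (Fin n) × ℝ, z.2 ≠ 0 := by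
  have h : {z : EuclideanSpace ℝ (Fin n) × ℝ | ¬ z.2 ≠ 0} = univ ×ˢ {0} := by
    ext z
    simp
  rw [ae_iff, h, Measure.volume_eq_prod, Measure.prod_prod]
  simp

/-- A Borel version of the positive part of `f` that vanishes everywhere for `t ≤ 0`, with finite
`L^p` norms on strips. -/
theorem exists_measurable_representative {p : ℝ} (hp : 1 ≤ p)
    {f : EuclideanSpace ℝ (Fin n) × ℝ → ℝ} (hf : f ∈ X n p)
    (hf0 : ∀ᵐ z : EuclideanSpace ℝ (Fin n) × ℝ, z.2 < 0 → f z = 0) :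
    ∃ F : EuclideanSpace ℝ (Fin n) × ℝ → ℝ≥0∞, Measurable F ∧ (∀ w, w.2 ≤ 0 → F w = 0) ∧
      F =ᵐ[volume] (fun z => ENNReal.ofReal (f z)) ∧
      ∀ T : ℝ, ∫⁻ z in univ ×ˢ Ioo 0 T, F z ^ p ≠ ∞ := by
  have hfm : AEMeasurable f := by
    have h := aemeasurable_iUnion_iff.2 fun k : ℕ => (hf k).aemeasurable
    have hU : (⋃ k : ℕ, (univ ×ˢ Iio (k : ℝ) : Set (EuclideanSpace ℝ (Fin n) × ℝ))) = univ := by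
      refine eq_univ_of_forall fun z => mem_iUnion.2 ?_
      obtain ⟨k, hk⟩ := exists_nat_gt z.2
      exact ⟨k, mem_univ _, hk⟩
    rwa [hU, Measure.restrict_univ] at h
  have hS : MeasurableSet (univ ×ˢ Ioi 0 : Set (EuclideanSpace ℝ (Fin n) × ℝ)) :=
    MeasurableSet.univ.prod measurableSet_Ioi
  have hFf : (univ ×ˢ Ioi 0 : Set (EuclideanSpace ℝ (Fin n) × ℝ)).indicator
      (fun z => ENNReal.ofReal (hfm.mk f z)) =ᵐ[volume] fun z => ENNReal.ofReal (f z) := by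
    filter_upwards [hfm.ae_eq_mk, hf0, ae_snd_ne_zero] with z hz hz0 hne
    rcases lt_or_ge 0 z.2 with h | h
    · have hzS : z ∈ (univ ×ˢ Ioi 0 : Set (EuclideanSpace ℝ (Fin n) × ℝ)) := ⟨mem_univ _, h⟩
      rw [indicator_of_mem hzS, hz]
    · rw [indicator_of_notMem (fun hmem => h.not_gt hmem.2), hz0 (lt_of_le_of_ne h hne),
        ENNReal.ofReal_zero]
  refine ⟨_, hfm.measurable_mk.ennreal_ofReal.indicator hS, fun w hw =>
    indicator_of_notMem (fun hmem => hw.not_gt hmem.2) _, hFf, fun T => ?_⟩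
  have hp0 : 0 < p := by linarith
  have hfin := lintegral_rpow_enorm_lt_top_of_eLpNorm_lt_top (ENNReal.ofReal_pos.2 hp0).ne'
    ENNReal.ofReal_ne_top (hf T).2
  rw [ENNReal.toReal_ofReal hp0.le] at hfin
  refine ne_top_of_le_ne_top hfin.ne ?_
  calc _ ≤ ∫⁻ z in univ ×ˢ Ioo 0 T, ‖f z‖ₑ ^ p :=
        lintegral_mono_ae (ae_restrict_of_ae (hFf.mono fun z hz => by
          rw [hz]
          exact ENNReal.rpow_le_rpow (Real.ofReal_le_enorm _) hp0.le))
    _ ≤ ∫⁻ z in univ ×ˢ Iio T, ‖f z‖ₑ ^ p :=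
        lintegral_mono_set (prod_mono_right Ioo_subset_Iio_self)

/-- This holds for negative `x` too, where `x ^ s` is `|x| ^ s` times a cosine. -/
theorem ofReal_rpow_le_enorm_rpow {s : ℝ} (hs : 0 < s) (x : ℝ) :
    ENNReal.ofReal (x ^ s) ≤ ‖x‖ₑ ^ s := by
  rw [Real.enorm_eq_ofReal_abs, ENNReal.ofReal_rpow_of_nonneg (abs_nonneg x) hs.le]
  exact ENNReal.ofReal_le_ofReal ((le_abs_self _).trans (Real.abs_rpow_le_abs_rpow x s))

theorem eLpNorm_top_strip_le {u : EuclideanSpace ℝ (Fin n) × ℝ → ℝ} {C γ : ℝ} (hC : 0 ≤ C)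
    (hγ : 0 ≤ γ) (hu : ∀ᵐ z, ‖u z‖ₑ ≤ ENNReal.ofReal C * timePower γ z.2) (T : ℝ) :
    eLpNorm u ⊤ (volume.restrict (univ ×ˢ Ioo 0 T : Set (EuclideanSpace ℝ (Fin n) × ℝ))) ≤
      ENNReal.ofReal (C * T ^ γ) := by
  rw [eLpNorm_exponent_top]
  refine eLpNormEssSup_le_of_ae_enorm_bound
    ((ae_restrict_iff' (MeasurableSet.univ.prod measurableSet_Ioo)).2 (hu.mono fun z hz hzT => ?_))
  have h0 : 0 < z.2 := hzT.2.1
  rw [timePower_of_pos h0, ← ENNReal.ofReal_mul hC] at hz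
  refine hz.trans (ENNReal.ofReal_le_ofReal (mul_le_mul_of_nonneg_left ?_ hC))
  exact Real.rpow_le_rpow h0.le hzT.2.2.le hγ

theorem M₂_nonneg {lam σ : ℝ} (hα : 0 < α) (hβ : 0 < β) (h₁ : 0 ≤ gamma₁ lam σ α β)
    (h₂ : 0 ≤ gamma₂ lam σ α β) : 0 ≤ M₂ lam σ α β := by
  rw [M₂_eq hα h₁]
  have := gammaRatio_pos hα h₁
  have := gammaRatio_pos hβ h₂
  positivity

end FracHeat

end

theorem theorem2p2 (n : ℕ) (hn : 1 ≤ n) (p q lam σ α β : ℝ)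
    (hp : 1 ≤ p) (hq : 1 ≤ q) (hlam : 0 < lam) (hσ : 0 < σ) (hα : 0 < α) (hβ : 0 < β)
    (hpα : FracHeat.Admissible n p α) (hqβ : FracHeat.Admissible n q β)
    (hord : ((n : ℝ) + 2 - 2 * p * α) * q ^ 2 * σ ≤ ((n : ℝ) + 2 - 2 * q * β) * p ^ 2 * lam)
    (hsub : 2 * p * α < (n : ℝ) + 2)
    (hB : σ < 1 / lam)
    (u v : EuclideanSpace ℝ (Fin n) × ℝ → ℝ)
    (hu : u ∈ FracHeat.Y n p α) (hv : v ∈ FracHeat.Y n q β)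
    -- `f = (∂_t - Δ)^α u` and `g = (∂_t - Δ)^β v`
    (f g : EuclideanSpace ℝ (Fin n) × ℝ → ℝ)
    (hf : FracHeat.IsFracHeat n p α u f) (hg : FracHeat.IsFracHeat n q β v g)
    (hfv : ∀ᵐ z ∂(volume : Measure (EuclideanSpace ℝ (Fin n) × ℝ)), 0 ≤ f z ∧ f z ≤ v z ^ lam)
    (hgu : ∀ᵐ z ∂(volume : Measure (EuclideanSpace ℝ (Fin n) × ℝ)), 0 ≤ g z ∧ g z ≤ u z ^ σ)
    (hinit : ∀ᵐ z ∂(volume : Measure (EuclideanSpace ℝ (Fin n) × ℝ)),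
      z.2 < 0 → u z = 0 ∧ v z = 0) :
    ∀ T : ℝ, 0 < T →
      eLpNorm u ⊤ (volume.restrict
          (Set.univ ×ˢ Set.Ioo 0 T : Set (EuclideanSpace ℝ (Fin n) × ℝ))) ≤
        ENNReal.ofReal (FracHeat.M₂ lam σ α β ^ (lam / (1 - lam * σ)) *
          T ^ (FracHeat.gamma₂ lam σ α β / σ)) ∧
      eLpNorm v ⊤ (volume.restrict
          (Set.univ ×ˢ Set.Ioo 0 T : Set (EuclideanSpace ℝ (Fin n) × ℝ))) ≤
        ENNReal.ofReal (FracHeat.M₁ lam σ α β ^ (σ / (1 - lam * σ)) *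
          T ^ (FracHeat.gamma₁ lam σ α β / lam)) := by
  intro T _
  have hθ : lam * σ < 1 := by rwa [lt_div_iff₀ hlam, mul_comm] at hB
  have hf0 : ∀ᵐ z : EuclideanSpace ℝ (Fin n) × ℝ, z.2 < 0 → f z = 0 := by
    filter_upwards [hfv, hinit] with z hz hz0 ht
    rw [(hz0 ht).2, Real.zero_rpow hlam.ne'] at hz
    exact le_antisymm hz.2 hz.1
  have hg0 : ∀ᵐ z : EuclideanSpace ℝ (Fin n) × ℝ, z.2 < 0 → g z = 0 := by
    filter_upwards [hgu, hinit] with z hz hz0 ht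
    rw [(hz0 ht).1, Real.zero_rpow hσ.ne'] at hz
    exact le_antisymm hz.2 hz.1
  obtain ⟨F, hFm, hF0, hFf, hFp⟩ := FracHeat.exists_measurable_representative hp hf.1 hf0
  obtain ⟨G, hGm, hG0, hGg, hGq⟩ := FracHeat.exists_measurable_representative hq hg.1 hg0
  have hu' : ∀ᵐ z, ‖u z‖ₑ ≤ FracHeat.heatPotential n α F z := by
    filter_upwards [hf.2] with z hz
    rw [← hz, FracHeat.heatPotential_congr_ae hFf]
    exact FracHeat.enorm_J_le hα (hfv.mono fun _ h => h.1) z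
  have hv' : ∀ᵐ z, ‖v z‖ₑ ≤ FracHeat.heatPotential n β G z := by
    filter_upwards [hg.2] with z hz
    rw [← hz, FracHeat.heatPotential_congr_ae hGg]
    exact FracHeat.enorm_J_le hβ (hgu.mono fun _ h => h.1) z
  have hFG : ∀ᵐ z, F z ≤ FracHeat.heatPotential n β G z ^ lam := by
    filter_upwards [hFf, hfv, hv'] with z h1 h2 h3
    rw [h1]
    exact (ENNReal.ofReal_le_ofReal h2.2).trans
      ((FracHeat.ofReal_rpow_le_enorm_rpow hlam _).trans (ENNReal.rpow_le_rpow h3 hlam.le))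
  have hGF : ∀ᵐ z, G z ≤ FracHeat.heatPotential n α F z ^ σ := by
    filter_upwards [hGg, hgu, hu'] with z h1 h2 h3
    rw [h1]
    exact (ENNReal.ofReal_le_ofReal h2.2).trans
      ((FracHeat.ofReal_rpow_le_enorm_rpow hσ _).trans (ENNReal.rpow_le_rpow h3 hσ.le))
  have hbound := FracHeat.heatPotential_le_of_sublinear hα hβ hlam hσ hθ hp hq hFm hGm hF0 hG0
    hFG hGF hFp hGq
  have h₁ : 0 ≤ FracHeat.gamma₁ lam σ α β := FracHeat.gamma₁_nonneg hα hβ hlam hσ hθ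
  have h₂ : 0 ≤ FracHeat.gamma₂ lam σ α β := by
    rw [← FracHeat.gamma₁_swap]
    exact FracHeat.gamma₁_nonneg hβ hα hσ hlam (by rwa [mul_comm])
  have hM₂ : 0 ≤ FracHeat.M₂ lam σ α β := FracHeat.M₂_nonneg hα hβ h₁ h₂
  have hM₁ : 0 ≤ FracHeat.M₁ lam σ α β := by
    rw [← FracHeat.M₂_swap]
    exact FracHeat.M₂_nonneg hβ hα (by rwa [FracHeat.gamma₁_swap])
      (by rwa [FracHeat.gamma₂_swap])
  exact ⟨FracHeat.eLpNorm_top_strip_le (Real.rpow_nonneg hM₂ _) (div_nonneg h₂ hσ.le)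
      (hu'.mono fun z hz => hz.trans (hbound z).1) T,
    FracHeat.eLpNorm_top_strip_le (Real.rpow_nonneg hM₁ _) (div_nonneg h₁ hlam.le)
      (hv'.mono fun z hz => hz.trans (hbound z).2) T⟩
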